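/- Let $d\ge 1$, let $(B_t,\ 0\le t\le 1)$ be a standard Brownian motion in $\mathbb{R}^d$, and let $f:[0,1]\to\mathbb{R}^d$ be a continuous function. For $g:[0,1]\to\mathbb{R}^d$ write $G(g)=\{(t,g(t)) : t\in[0,1]\}\subset\mathbb{R}^{d+1}$ for its graph, and let $\dim$ denote Hausdorff dimension (with respect to the Euclidean metric). (a) If $d=1$, then almost surely $\dim G(B+f)\ge \max\{\tfrac32,\ \dim G(f)\}$. (b) If $d\ge 2$, then almost surely $\dim G(B+f)\ge \max\{2,\ \dim G(f)\}$. -/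

import Mathlib

open MeasureTheory ProbabilityTheory
open scoped ENNReal unitInterval

/-- A standard Brownian motion `(B_t, 0 ≤ t ≤ 1)` in `ℝ^d`: it starts at `0`, has independent
increments, `B_t - B_s` is a centred Gaussian vector with covariance matrix `(t - s) • 1` (the law
of `√(t - s) Z` with `Z` standard Gaussian), and almost every path is continuous. -/
structure IsStandardBrownianMotion {Ω : Type*} [MeasurableSpace Ω] {d : ℕ}
    (B : I → Ω → EuclideanSpace ℝ (Fin d)) (P : Measure Ω) : Prop where
  start : ∀ᵐ ω ∂P, B 0 ω = 0
  indep : HasIndepIncrements B P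
  law : ∀ s t : I, s ≤ t →
    HasLaw (fun ω ↦ B t ω - B s ω)
      ((stdGaussian (EuclideanSpace ℝ (Fin d))).map (fun z ↦ √((t : ℝ) - (s : ℝ)) • z)) P
  cont : ∀ᵐ ω ∂P, Continuous (fun t ↦ B t ω)

/-- The graph `{(t, g t) : t ∈ [0,1]}` of `g : [0,1] → ℝ^d`, as a subset of `ℝ × ℝ^d` with the
Euclidean metric `(|t - s|² + ‖x - y‖²)^(1/2)`. -/
def euclideanGraph {d : ℕ} (g : I → EuclideanSpace ℝ (Fin d)) :
    Set (WithLp 2 (ℝ × EuclideanSpace ℝ (Fin d))) :=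
  Set.range fun t : I ↦ WithLp.toLp 2 ((t : ℝ), g t)

/-! The proof is an energy argument with respect to the parabolic gauge ρ(t,u) = max(|t-u|, ‖f t - f
u‖²) on the time interval. An increment of `B` over time τ has size about √τ, so it blurs the graph
of `f` at the parabolic scale. For 0 < s₀ ≤ s and s₀ < d, the expected value of |γ(t) - γ(u)|^(-s),
where γ(t) = (t, B_t + f(t)), is at most a constant times ρ(t,u)^(-(s - s₀/2))
(`exists_lintegral_stdGaussian_kernel_le`). Taking s₀ = s when s < d and s₀ just below d otherwise
brings the exponent to, or arbitrarily close to, max(s/2, s - d/2).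

Hence, if a probability measure ν on times gives ρ-balls of radius r mass O(r^a) with a > max(s/2, s
- d/2), then by Tonelli the image of ν under γ almost surely has finite s-energy, and the graph has
dimension at least s (`ae_le_dimH_euclideanGraph`).

Two choices of ν suffice. Lebesgue measure has a = 1, which allows every s < min(2, 1 + d/2): this
gives 3/2 and 2. If dim G(f) > s', Frostman's lemma is run along parabolic boxes of size 4⁻ᵏ in time
and 2⁻ᵏ in space. Such a box is covered by one set of diameter about 2⁻ᵏ or by 2^(kd) sets of
diameter about 4⁻ᵏ, so its s'-content is at most of order (4⁻ᵏ)^a with a = max(s'/2, s' - d/2). This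
is the exponent demanded by the energy bound, so every s < s' is reached. -/

/-! ### Energy method and integrals over dyadic scales -/

/-- A set charged by a measure of finite `s`-energy has Hausdorff dimension at least `s`. -/
theorem le_dimH_of_lintegral_edist_rpow_neg_ne_top {X : Type*} [MetricSpace X]
    [SecondCountableTopology X] [MeasurableSpace X] [BorelSpace X] (μ : Measure X)
    [IsFiniteMeasure μ] {A : Set X} (hA : μ A ≠ 0) {s : NNReal} (hs : 0 < s)
    (h : ∫⁻ x, ∫⁻ y, edist x y ^ (-(s : ℝ)) ∂μ ∂μ ≠ ∞) : (s : ℝ≥0∞) ≤ dimH A := by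
  set φ : X → ℝ≥0∞ := fun x ↦ ∫⁻ y, edist x y ^ (-(s : ℝ)) ∂μ with hφ
  have hmeas : Measurable φ := by
    have : Measurable (fun p : X × X ↦ edist p.1 p.2 ^ (-(s : ℝ))) := by fun_prop
    exact this.lintegral_prod_right'
  have hfin : ∀ᵐ x ∂μ, φ x < ∞ := ae_lt_top hmeas h
  obtain ⟨n, hn⟩ : ∃ n : ℕ, μ (A ∩ {x | φ x ≤ n}) ≠ 0 := by
    by_contra! hcon
    have h1 : μ (⋃ n : ℕ, A ∩ {x | φ x ≤ n}) = 0 := measure_iUnion_null hcon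
    apply hA
    refine measure_mono_null_ae ?_ h1
    filter_upwards [hfin] with x hx hxA
    obtain ⟨n, hn⟩ := ENNReal.exists_nat_gt hx.ne
    exact Set.mem_iUnion.2 ⟨n, hxA, hn.le⟩
  set S : Set X := {x | φ x ≤ n}
  have hS : MeasurableSet S := measurableSet_le hmeas measurable_const
  -- On `S` the potential is at most `n`, so a set `U` meeting `S` lies in a ball of radius diam U
  -- with mass O((diam U)^s). Normalising by `n + 1` rather than `n` keeps the inverse finite when
  -- `n = 0`.
  have key : ∀ U : Set X, Metric.ediam U ≤ 1 →
      ((n + 1 : ℝ≥0∞)⁻¹ • μ.restrict S) U ≤ Metric.ediam U ^ (s : ℝ) := by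
    intro U hU
    rw [Measure.smul_apply, Measure.restrict_apply' hS, smul_eq_mul]
    rcases (U ∩ S).eq_empty_or_nonempty with he | ⟨x, hxU, hxS⟩
    · simp [he]
    have h1 : Metric.ediam U ^ (-(s : ℝ)) * μ (U ∩ S) ≤ n + 1 := by
      calc Metric.ediam U ^ (-(s : ℝ)) * μ (U ∩ S)
          ≤ Metric.ediam U ^ (-(s : ℝ)) * μ (Metric.closedEBall x (Metric.ediam U)) := by
            gcongr
            intro y hy
            rw [Metric.mem_closedEBall]
            exact Metric.edist_le_ediam_of_mem hy.1 hxU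
        _ = ∫⁻ y in Metric.closedEBall x (Metric.ediam U), Metric.ediam U ^ (-(s : ℝ)) ∂μ := by
            rw [setLIntegral_const]
        _ ≤ ∫⁻ y in Metric.closedEBall x (Metric.ediam U), edist x y ^ (-(s : ℝ)) ∂μ := by
            refine setLIntegral_mono' Metric.isClosed_closedEBall.measurableSet fun y hy ↦ ?_
            rw [ENNReal.rpow_neg, ENNReal.rpow_neg]
            refine ENNReal.inv_le_inv.2 (ENNReal.rpow_le_rpow ?_ s.2)
            rw [edist_comm]; exact hy
        _ ≤ φ x := setLIntegral_le_lintegral _ _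
        _ ≤ n + 1 := hxS.trans le_self_add
    rw [ENNReal.inv_mul_le_iff (by simp) (by simp)]
    rw [ENNReal.rpow_neg, mul_comm, ← div_eq_mul_inv] at h1
    -- Since 0^(-s) = ∞, finiteness of the potential forces a set of diameter zero to be null.
    rcases eq_or_ne (Metric.ediam U) 0 with h0 | h0
    · rw [h0, ENNReal.zero_rpow_of_pos (by positivity)] at h1 ⊢
      rw [ENNReal.div_le_iff_le_mul (by simp) (by simp)] at h1
      simpa using h1
    · have hne : Metric.ediam U ≠ ∞ := (hU.trans_lt ENNReal.one_lt_top).ne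
      rwa [ENNReal.div_le_iff_le_mul (Or.inl ?_) (Or.inl ?_)] at h1
      · simp [h0, hne]
      · simp [h0, hne]
  have hle := Measure.le_hausdorffMeasure (s : ℝ) _ 1 one_pos key
  apply le_dimH_of_hausdorffMeasure_ne_zero
  intro h0
  have := hle A
  rw [h0, Measure.smul_apply, Measure.restrict_apply' hS, smul_eq_mul, nonpos_iff_eq_zero,
    mul_eq_zero] at this
  rcases this with h2 | h2
  · simp [ENNReal.inv_eq_zero] at h2
  · exact hn h2

/-- For 0 < x < 1 the single term with 2^(-(n+1)) < x ≤ 2^(-n) already dominates; at x = 0 the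
series diverges; for x ≥ 1 the summand 1 is enough. -/
theorem ENNReal.rpow_neg_le_one_add_tsum {b : ℝ} (hb : 0 < b) (x : ℝ≥0∞) :
    x ^ (-b) ≤ 1 + ∑' k : ℕ, if x ≤ 2⁻¹ ^ k then (2 : ℝ≥0∞) ^ (((k : ℝ) + 1) * b) else 0 := by
  rcases le_or_gt 1 x with h1 | h1
  · refine le_trans ?_ le_self_add
    rw [ENNReal.rpow_neg]
    exact ENNReal.inv_le_one.2 (ENNReal.one_le_rpow h1 hb)
  refine le_trans ?_ le_add_self
  rcases eq_or_ne x 0 with rfl | h0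
  · have : ∑' k : ℕ, (if (0 : ℝ≥0∞) ≤ 2⁻¹ ^ k then (2 : ℝ≥0∞) ^ (((k : ℝ) + 1) * b) else 0) = ∞ := by
      rw [eq_top_iff, ← ENNReal.tsum_const_eq_top_of_ne_zero (α := ℕ) one_ne_zero]
      refine ENNReal.tsum_le_tsum fun k ↦ ?_
      rw [if_pos (zero_le)]
      exact ENNReal.one_le_rpow (by norm_num) (by positivity)
    rw [this]
    exact le_top
  · have hx : x ≠ ∞ := (h1.trans ENNReal.one_lt_top).ne
    obtain ⟨n, hn1, hn2⟩ := exists_nat_pow_near_of_lt_one (ENNReal.toReal_pos h0 hx)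
      (by simpa using ENNReal.toReal_mono ENNReal.one_ne_top h1.le)
      (by norm_num : (0 : ℝ) < 2⁻¹) (by norm_num)
    have e (m : ℕ) : (2⁻¹ : ℝ≥0∞) ^ m = ENNReal.ofReal (2⁻¹ ^ m) := by
      rw [ENNReal.ofReal_pow (by norm_num), ENNReal.ofReal_inv_of_pos (by norm_num)]
      simp
    have hn1' : (2⁻¹ : ℝ≥0∞) ^ (n + 1) ≤ x := by
      rw [e]; exact ENNReal.ofReal_le_of_le_toReal hn1.le
    have hn2' : x ≤ 2⁻¹ ^ n := by
      rw [e]; exact (ENNReal.le_ofReal_iff_toReal_le hx (by positivity)).2 hn2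
    refine le_trans ?_ (ENNReal.le_tsum n)
    rw [if_pos hn2', ENNReal.rpow_neg, ENNReal.inv_le_iff_inv_le, ← ENNReal.rpow_neg]
    calc (2 : ℝ≥0∞) ^ (-(((n : ℝ) + 1) * b)) = ((2⁻¹ : ℝ≥0∞) ^ (n + 1)) ^ b := by
          rw [← ENNReal.rpow_natCast, ← ENNReal.rpow_mul, ENNReal.inv_rpow, ← ENNReal.rpow_neg]
          simp
      _ ≤ x ^ b := ENNReal.rpow_le_rpow hn1' hb.le

/-- Integrability of a negative power of a function with polynomially small sublevel sets. -/
theorem lintegral_rpow_neg_le {X : Type*} [MeasurableSpace X] (μ : Measure X) {ρ : X → ℝ≥0∞}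
    (hρ : Measurable ρ) {C : ℝ≥0∞} {a b : ℝ} (hb : 0 < b)
    (h : ∀ k : ℕ, μ {x | ρ x ≤ 2⁻¹ ^ k} ≤ C * (2⁻¹ ^ k) ^ a) :
    ∫⁻ x, ρ x ^ (-b) ∂μ ≤ μ Set.univ + C * (2 ^ b * (1 - 2 ^ (b - a))⁻¹) := by
  calc ∫⁻ x, ρ x ^ (-b) ∂μ
      ≤ ∫⁻ x, (1 + ∑' k : ℕ, ({x | ρ x ≤ 2⁻¹ ^ k}.indicator
          (fun _ ↦ (2 : ℝ≥0∞) ^ (((k : ℝ) + 1) * b))) x) ∂μ := by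
        refine lintegral_mono fun x ↦ ?_
        simpa [Set.indicator_apply] using ENNReal.rpow_neg_le_one_add_tsum hb (ρ x)
    _ = μ Set.univ + ∑' k : ℕ, 2 ^ (((k : ℝ) + 1) * b) * μ {x | ρ x ≤ 2⁻¹ ^ k} := by
        rw [lintegral_add_left measurable_const, lintegral_const, one_mul, lintegral_tsum]
        · congr 2 with k
          rw [lintegral_indicator_const (measurableSet_le hρ measurable_const)]
        · exact fun k ↦ (measurable_const.indicator
            (measurableSet_le hρ measurable_const)).aemeasurable
    _ ≤ μ Set.univ + ∑' k : ℕ, C * (2 ^ b * (2 ^ (b - a)) ^ k) := by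
        refine add_le_add le_rfl (ENNReal.tsum_le_tsum fun k ↦ ?_)
        refine (mul_le_mul_right (h k) _).trans_eq ?_
        have e : (2 : ℝ≥0∞) ^ (((k : ℝ) + 1) * b) * (2⁻¹ ^ k) ^ a = 2 ^ b * (2 ^ (b - a)) ^ k := by
          rw [← ENNReal.rpow_natCast, ← ENNReal.rpow_natCast, ← ENNReal.rpow_mul,
            ← ENNReal.rpow_mul, ENNReal.inv_rpow, ← ENNReal.rpow_neg,
            ← ENNReal.rpow_add _ _ (by simp) (by simp), ← ENNReal.rpow_add _ _ (by simp) (by simp)]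
          congr 1; ring
        rw [mul_left_comm, e]
    _ = _ := by
        rw [ENNReal.tsum_mul_left, ENNReal.tsum_mul_left, ENNReal.tsum_geometric]

theorem two_rpow_mul_inv_one_sub_ne_top {a b : ℝ} (hab : b < a) :
    (2 : ℝ≥0∞) ^ b * (1 - 2 ^ (b - a))⁻¹ ≠ ∞ := by
  refine ENNReal.mul_ne_top (ENNReal.rpow_ne_top_of_ne_zero (by simp) (by simp)) ?_
  rw [ENNReal.inv_ne_top]
  exact (tsub_pos_of_lt (ENNReal.rpow_lt_one_of_one_lt_of_neg (by norm_num) (by linarith))).ne'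

/-! ### Gaussian potentials and the parabolic kernel bound -/

/-- The weight cancels half of the Gaussian exponent. What is left is still integrable and has
density at most 1, and the spare factor exp(x²/4) pays for large deviations in the kernel bound. -/
theorem lintegral_exp_sq_gaussianReal_eq (S : Set ℝ) (hS : MeasurableSet S) :
    ∫⁻ x in S, ENNReal.ofReal (Real.exp (x ^ 2 / 4)) ∂(gaussianReal 0 1) =
      ∫⁻ x in S, ENNReal.ofReal ((√(2 * Real.pi))⁻¹ * Real.exp (-(1 / 4) * x ^ 2)) := by
  rw [gaussianReal_of_var_ne_zero _ one_ne_zero,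
    setLIntegral_withDensity_eq_setLIntegral_mul _ (measurable_gaussianPDF _ _) (by fun_prop) hS]
  refine lintegral_congr fun x ↦ ?_
  rw [Pi.mul_apply, gaussianPDF, gaussianPDFReal_def, ← ENNReal.ofReal_mul (by positivity),
    mul_assoc, ← Real.exp_add]
  simp only [NNReal.coe_one, mul_one, sub_zero]
  congr 3; ring

theorem setLIntegral_exp_sq_gaussianReal_le (S : Set ℝ) (hS : MeasurableSet S) :
    ∫⁻ x in S, ENNReal.ofReal (Real.exp (x ^ 2 / 4)) ∂(gaussianReal 0 1) ≤ volume S := by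
  rw [lintegral_exp_sq_gaussianReal_eq S hS]
  calc _ ≤ ∫⁻ x in S, 1 := by
        refine lintegral_mono fun x ↦ ?_
        rw [ENNReal.ofReal_le_one]
        have h1 : (√(2 * Real.pi))⁻¹ ≤ 1 := by
          apply inv_le_one_of_one_le₀
          rw [Real.one_le_sqrt]
          linarith [Real.pi_gt_three]
        have h2 : Real.exp (-(1 / 4) * x ^ 2) ≤ 1 := by
          rw [Real.exp_le_one_iff]; nlinarith [sq_nonneg x]
        exact mul_le_one₀ h1 (Real.exp_nonneg _) h2
    _ = volume S := by simp

theorem lintegral_exp_sq_gaussianReal_ne_top :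
    ∫⁻ x, ENNReal.ofReal (Real.exp (x ^ 2 / 4)) ∂(gaussianReal 0 1) ≠ ∞ := by
  rw [← setLIntegral_univ, lintegral_exp_sq_gaussianReal_eq _ MeasurableSet.univ,
    setLIntegral_univ]
  exact (((integrable_exp_neg_mul_sq (b := 1 / 4) (by norm_num)).const_mul _).lintegral_lt_top).ne

theorem lintegral_prod_stdGaussian {d : ℕ} (g : Fin d → ℝ → ℝ≥0∞) (hg : ∀ i, Measurable (g i)) :
    ∫⁻ z, ∏ i, g i (z i) ∂(stdGaussian (EuclideanSpace ℝ (Fin d))) =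
      ∏ i, ∫⁻ x, g i x ∂(gaussianReal 0 1) := by
  rw [← map_pi_eq_stdGaussian, lintegral_map (by fun_prop) (by fun_prop)]
  have hind : iIndepFun (fun i (x : Fin d → ℝ) ↦ g i (x i))
      (Measure.pi fun _ : Fin d ↦ gaussianReal 0 1) :=
    iIndepFun_pi (fun i ↦ (hg i).aemeasurable)
  rw [lintegral_prod_eq_prod_lintegral_of_indepFun _ _ hind (by fun_prop)]
  refine Finset.prod_congr rfl fun i _ ↦ ?_
  have := (measurePreserving_eval (fun _ : Fin d ↦ gaussianReal 0 1) i).lintegral_comp (hg i)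
  exact this

/-- The finite measure with density proportional to `exp (-‖z‖² / 4)`. -/
noncomputable def wideGaussian (d : ℕ) : Measure (EuclideanSpace ℝ (Fin d)) :=
  (stdGaussian (EuclideanSpace ℝ (Fin d))).withDensity
    fun z ↦ ENNReal.ofReal (Real.exp (‖z‖ ^ 2 / 4))

theorem ofReal_exp_norm_sq_eq_prod {d : ℕ} (z : EuclideanSpace ℝ (Fin d)) :
    ENNReal.ofReal (Real.exp (‖z‖ ^ 2 / 4)) =
      ∏ i, ENNReal.ofReal (Real.exp (z i ^ 2 / 4)) := by
  rw [← ENNReal.ofReal_prod_of_nonneg (fun _ _ ↦ Real.exp_nonneg _), ← Real.exp_sum,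
    EuclideanSpace.norm_sq_eq, Finset.sum_div]
  simp

theorem wideGaussian_univ_ne_top (d : ℕ) : wideGaussian d Set.univ ≠ ∞ := by
  rw [wideGaussian, withDensity_apply _ MeasurableSet.univ, setLIntegral_univ]
  simp_rw [ofReal_exp_norm_sq_eq_prod]
  rw [lintegral_prod_stdGaussian (fun _ x ↦ ENNReal.ofReal (Real.exp (x ^ 2 / 4)))
    (fun _ ↦ by fun_prop)]
  exact ENNReal.prod_ne_top fun _ _ ↦ lintegral_exp_sq_gaussianReal_ne_top

/-- The ball sits in a cube of side 2r, and the measure is a product of one-dimensional measures of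
density at most 1. -/
theorem wideGaussian_closedBall_le {d : ℕ} (w : EuclideanSpace ℝ (Fin d)) {r : ℝ≥0∞}
    (hr : r ≠ ∞) : wideGaussian d {z | ‖z + w‖ₑ ≤ r} ≤ (2 * r) ^ d := by
  have hmeas : MeasurableSet {z : EuclideanSpace ℝ (Fin d) | ‖z + w‖ₑ ≤ r} :=
    measurableSet_le (by fun_prop) measurable_const
  lift r to NNReal using hr
  have hI (i : Fin d) : MeasurableSet (Metric.closedBall (-(w i)) (r : ℝ)) :=
    Metric.isClosed_closedBall.measurableSet
  rw [wideGaussian, withDensity_apply _ hmeas, ← lintegral_indicator hmeas]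
  calc _ ≤ ∫⁻ z, ∏ i, (Metric.closedBall (-(w i)) (r : ℝ)).indicator
          (fun x ↦ ENNReal.ofReal (Real.exp (x ^ 2 / 4))) (z i)
          ∂(stdGaussian (EuclideanSpace ℝ (Fin d))) := by
        refine lintegral_mono fun z ↦ ?_
        rw [Set.indicator_apply]
        split_ifs with hz
        swap
        · exact zero_le
        rw [ofReal_exp_norm_sq_eq_prod]
        refine (Finset.prod_congr rfl fun i _ ↦ ?_).le
        rw [Set.indicator_of_mem]
        rw [Metric.mem_closedBall, Real.dist_eq, sub_neg_eq_add]
        have h1 : ‖z + w‖ ≤ r := by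
          have : ‖z + w‖ₑ ≤ r := hz
          rw [← ofReal_norm, ← ENNReal.ofReal_coe_nnreal] at this
          exact (ENNReal.ofReal_le_ofReal_iff r.2).1 this
        have h2 := PiLp.norm_apply_le (z + w) i
        simp only [PiLp.add_apply, Real.norm_eq_abs] at h2
        exact h2.trans h1
    _ = ∏ i, ∫⁻ x in Metric.closedBall (-(w i)) (r : ℝ), ENNReal.ofReal (Real.exp (x ^ 2 / 4))
          ∂(gaussianReal 0 1) := by
        rw [lintegral_prod_stdGaussian]
        · refine Finset.prod_congr rfl fun i _ ↦ ?_
          rw [lintegral_indicator (hI i)]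
        · exact fun i ↦ Measurable.indicator (by fun_prop) (hI i)
    _ ≤ ∏ _i : Fin d, (2 * (r : ℝ≥0∞)) := by
        refine Finset.prod_le_prod' fun i _ ↦ ?_
        refine (setLIntegral_exp_sq_gaussianReal_le _ (hI i)).trans_eq ?_
        rw [Real.volume_closedBall, ENNReal.ofReal_mul (by norm_num)]
        simp
    _ = _ := by simp

/-- Riesz potentials of order `s < d` of the Gaussian measure are uniformly bounded. -/
theorem exists_lintegral_wideGaussian_le {d : ℕ} {s : ℝ} (hs : 0 < s) (hsd : s < d) :
    ∃ J : ℝ≥0∞, J ≠ ∞ ∧ ∀ w : EuclideanSpace ℝ (Fin d),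
      ∫⁻ z, ‖z + w‖ₑ ^ (-s) ∂(wideGaussian d) ≤ J := by
  refine ⟨_, ?_, fun w ↦ lintegral_rpow_neg_le (C := 2 ^ d) (a := d) _ (by fun_prop) hs
    fun k ↦ ?_⟩
  · exact ENNReal.add_ne_top.2 ⟨wideGaussian_univ_ne_top d,
      ENNReal.mul_ne_top (by simp) (two_rpow_mul_inv_one_sub_ne_top hsd)⟩
  · refine (wideGaussian_closedBall_le w (by simp)).trans_eq ?_
    rw [mul_pow, ENNReal.rpow_natCast]

/-- Raise u ≤ exp u, at u = x/(16p), to the power p. The 16 comes from ‖z‖²/4 > ‖w‖²/16 when ‖z‖ >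
‖w‖/2. -/
theorem rpow_mul_exp_neg_le {p x : ℝ} (hp : 0 < p) (hx : 0 ≤ x) :
    x ^ p * Real.exp (-(x / 16)) ≤ (16 * p) ^ p := by
  have h1 : x / (16 * p) ≤ Real.exp (x / (16 * p)) := by
    linarith [Real.add_one_le_exp (x / (16 * p))]
  have h2 : (x / (16 * p)) ^ p ≤ Real.exp (x / 16) := by
    calc (x / (16 * p)) ^ p ≤ Real.exp (x / (16 * p)) ^ p := by gcongr
      _ = Real.exp (x / 16) := by
        rw [← Real.exp_mul]; congr 1; field_simp
  rw [Real.div_rpow hx (by positivity), div_le_iff₀ (by positivity)] at h2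
  rw [Real.exp_neg, ← div_eq_mul_inv, div_le_iff₀ (Real.exp_pos _), mul_comm]
  exact h2

/-- The parabolic bound for the truncated Riesz kernel of a shifted Gaussian vector. -/
theorem exists_lintegral_stdGaussian_kernel_le {d : ℕ} {s s₀ : ℝ} (hs₀ : 0 < s₀) (hd : s₀ < d)
    (hs : s₀ ≤ s) {M : ℝ} (hM : 0 < M) :
    ∃ K : ℝ≥0∞, K ≠ ∞ ∧ ∀ (τ : ℝ) (y : EuclideanSpace ℝ (Fin d)), 0 < τ → ‖y‖ ^ 2 ≤ M →
      ∫⁻ z, ENNReal.ofReal ((max τ ‖√τ • z + y‖) ^ (-s))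
          ∂(stdGaussian (EuclideanSpace ℝ (Fin d))) ≤
        K * ENNReal.ofReal ((max τ (‖y‖ ^ 2)) ^ (-(s - s₀ / 2))) := by
  obtain ⟨J, hJ, hJw⟩ := exists_lintegral_wideGaussian_le hs₀ hd
  set p := s - s₀ / 2 with hp
  have hp0 : 0 < p := by linarith
  set c₁ : ℝ := 2 ^ s * M ^ ((s - s₀) / 2)
  set c₂ : ℝ := (16 * p) ^ p
  have hc₁ : 0 ≤ c₁ := by positivity
  have hc₂ : 0 ≤ c₂ := by positivity
  refine ⟨J + (ENNReal.ofReal c₁ + ENNReal.ofReal c₂ * J), by finiteness, fun τ y hτ hy ↦ ?_⟩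
  set w : EuclideanSpace ℝ (Fin d) := (√τ)⁻¹ • y with hw
  have hsτ : 0 < √τ := Real.sqrt_pos.2 hτ
  have hX (z : EuclideanSpace ℝ (Fin d)) : ‖√τ • z + y‖ = √τ * ‖z + w‖ := by
    have : √τ • z + y = √τ • (z + w) := by
      rw [hw, smul_add, smul_smul, mul_inv_cancel₀ hsτ.ne', one_smul]
    rw [this, norm_smul, Real.norm_of_nonneg hsτ.le]
  -- the bound from the region where the truncation is not used
  have hker (z : EuclideanSpace ℝ (Fin d)) :
      ENNReal.ofReal ((max τ ‖√τ • z + y‖) ^ (-s)) ≤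
        ENNReal.ofReal (τ ^ (-p)) * ‖z + w‖ₑ ^ (-s₀) := by
    rcases eq_or_ne ‖z + w‖ 0 with h0 | h0
    · have : ‖z + w‖ₑ = 0 := by rw [← ofReal_norm, h0, ENNReal.ofReal_zero]
      rw [this, ENNReal.zero_rpow_of_neg (by linarith), ENNReal.mul_top]
      · exact le_top
      · simpa using Real.rpow_pos_of_pos hτ _
    · have hpos : 0 < ‖z + w‖ := lt_of_le_of_ne (norm_nonneg _) h0.symm
      rw [← ofReal_norm, ENNReal.ofReal_rpow_of_pos hpos,
        ← ENNReal.ofReal_mul (by positivity)]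
      apply ENNReal.ofReal_le_ofReal
      have hmax : 0 < max τ ‖√τ • z + y‖ := lt_max_of_lt_left hτ
      calc (max τ ‖√τ • z + y‖) ^ (-s)
          = (max τ ‖√τ • z + y‖) ^ (-(s - s₀)) * (max τ ‖√τ • z + y‖) ^ (-s₀) := by
            rw [← Real.rpow_add hmax]; congr 1; ring
        _ ≤ τ ^ (-(s - s₀)) * (√τ * ‖z + w‖) ^ (-s₀) := by
            gcongr ?_ * ?_
            · exact Real.rpow_le_rpow_of_nonpos hτ (le_max_left _ _) (by linarith)
            · rw [hX]
              exact Real.rpow_le_rpow_of_nonpos (by positivity) (le_max_right _ _) (by linarith)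
        _ = τ ^ (-p) * ‖z + w‖ ^ (-s₀) := by
            rw [Real.mul_rpow hsτ.le hpos.le, ← mul_assoc, Real.sqrt_eq_rpow, ← Real.rpow_mul hτ.le,
              ← Real.rpow_add hτ]
            congr 2; rw [hp]; ring
  have hG : ∫⁻ z, ‖z + w‖ₑ ^ (-s₀) * ENNReal.ofReal (Real.exp (‖z‖ ^ 2 / 4))
      ∂(stdGaussian (EuclideanSpace ℝ (Fin d))) ≤ J := by
    refine le_trans (le_of_eq ?_) (hJw w)
    rw [wideGaussian, lintegral_withDensity_eq_lintegral_mul _ (by fun_prop) (by fun_prop)]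
    simp [mul_comm]
  rcases le_or_gt (‖y‖ ^ 2) τ with hyτ | hyτ
  · rw [max_eq_left hyτ]
    calc _ ≤ ∫⁻ z, ENNReal.ofReal (τ ^ (-p)) *
            (‖z + w‖ₑ ^ (-s₀) * ENNReal.ofReal (Real.exp (‖z‖ ^ 2 / 4)))
            ∂(stdGaussian (EuclideanSpace ℝ (Fin d))) := by
          refine lintegral_mono fun z ↦ (hker z).trans ?_
          gcongr
          refine le_mul_of_one_le_right zero_le ?_
          rw [ENNReal.one_le_ofReal]
          exact Real.one_le_exp (by positivity)
      _ = ENNReal.ofReal (τ ^ (-p)) * ∫⁻ z,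
            (‖z + w‖ₑ ^ (-s₀) * ENNReal.ofReal (Real.exp (‖z‖ ^ 2 / 4)))
            ∂(stdGaussian (EuclideanSpace ℝ (Fin d))) := lintegral_const_mul _ (by fun_prop)
      _ ≤ ENNReal.ofReal (τ ^ (-p)) * (J + (ENNReal.ofReal c₁ + ENNReal.ofReal c₂ * J)) := by
          gcongr
          exact hG.trans le_self_add
      _ = _ := mul_comm _ _
  · rw [max_eq_right hyτ.le]
    set R := ‖y‖ ^ 2 with hR
    have hRpos : 0 < R := hτ.trans hyτ
    have hypos : 0 < ‖y‖ := by
      by_contra! h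
      have : ‖y‖ = 0 := le_antisymm h (norm_nonneg _)
      simp [hR, this] at hRpos
    have hwn : ‖w‖ ^ 2 = R / τ := by
      rw [hw, norm_smul, mul_pow, norm_inv, Real.norm_of_nonneg hsτ.le, inv_pow, Real.sq_sqrt hτ.le,
        hR]
      field_simp
    -- When ‖z‖ > ‖w‖/2, a factor exp(-R/(16τ)) can be borrowed from the weight exp(‖z‖²/4), and it
    -- turns τ^(-p) into R^(-p).
    have hfar : Real.exp (-(R / τ / 16)) * τ ^ (-p) ≤ c₂ * R ^ (-p) := by
      have h1 := rpow_mul_exp_neg_le hp0 (div_pos hRpos hτ).le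
      rw [Real.div_rpow hRpos.le hτ.le] at h1
      rw [Real.rpow_neg hτ.le, Real.rpow_neg hRpos.le, ← div_eq_mul_inv, ← div_eq_mul_inv,
        div_le_div_iff₀ (by positivity) (by positivity)]
      rw [div_mul_eq_mul_div, div_le_iff₀ (by positivity)] at h1
      linarith
    -- When ‖z‖ ≤ ‖w‖/2, the space distance is at least ‖y‖/2. Passing from R^(-s/2) to R^(-p) costs
    -- R^((s-s₀)/2), bounded because R ≤ M.
    have hnear : (‖y‖ / 2) ^ (-s) ≤ c₁ * R ^ (-p) := by
      have e1 : ‖y‖ = R ^ (1 / 2 : ℝ) := by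
        rw [← Real.sqrt_eq_rpow, hR, Real.sqrt_sq hypos.le]
      calc (‖y‖ / 2) ^ (-s) = 2 ^ s * R ^ (-(s / 2)) := by
            rw [Real.div_rpow hypos.le (by norm_num), e1, ← Real.rpow_mul hRpos.le,
              Real.rpow_neg (by norm_num : (0 : ℝ) ≤ 2), div_inv_eq_mul, mul_comm]
            congr 2; ring
        _ = 2 ^ s * R ^ ((s - s₀) / 2) * R ^ (-p) := by
            rw [mul_assoc, ← Real.rpow_add hRpos]
            congr 2; rw [hp]; ring
        _ ≤ c₁ * R ^ (-p) := by
            have h1 := Real.rpow_le_rpow hRpos.le hy (by linarith : 0 ≤ (s - s₀) / 2)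
            exact mul_le_mul_of_nonneg_right
              (mul_le_mul_of_nonneg_left h1 (by positivity)) (by positivity)
    have hpt (z : EuclideanSpace ℝ (Fin d)) :
        ENNReal.ofReal ((max τ ‖√τ • z + y‖) ^ (-s)) ≤ ENNReal.ofReal (c₁ * R ^ (-p)) +
          ENNReal.ofReal (c₂ * R ^ (-p)) *
            (‖z + w‖ₑ ^ (-s₀) * ENNReal.ofReal (Real.exp (‖z‖ ^ 2 / 4))) := by
      rcases le_or_gt ‖z‖ (‖w‖ / 2) with hz | hz
      · refine le_trans ?_ le_self_add
        refine ENNReal.ofReal_le_ofReal (le_trans ?_ hnear)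
        refine Real.rpow_le_rpow_of_nonpos (by positivity) (le_trans ?_ (le_max_right _ _))
          (by linarith)
        rw [hX]
        have h1 : ‖w‖ / 2 ≤ ‖z + w‖ := by
          have := norm_sub_le (z + w) z
          rw [add_sub_cancel_left] at this
          linarith
        have h2 : ‖y‖ = √τ * ‖w‖ := by
          rw [hw, norm_smul, norm_inv, Real.norm_of_nonneg hsτ.le]
          field_simp
        rw [h2]
        nlinarith
      · refine le_trans (hker z) (le_trans ?_ le_add_self)
        rw [mul_left_comm, mul_comm]
        gcongr
        rw [← ENNReal.ofReal_mul (by positivity)]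
        apply ENNReal.ofReal_le_ofReal
        calc τ ^ (-p) ≤ (Real.exp (-(R / τ / 16)) * τ ^ (-p)) * Real.exp (‖z‖ ^ 2 / 4) := by
              rw [mul_right_comm, ← Real.exp_add]
              refine le_mul_of_one_le_left (by positivity) (Real.one_le_exp ?_)
              rw [← hwn]
              nlinarith [norm_nonneg w]
          _ ≤ _ := by gcongr
    calc _ ≤ ∫⁻ z, (ENNReal.ofReal (c₁ * R ^ (-p)) + ENNReal.ofReal (c₂ * R ^ (-p)) *
            (‖z + w‖ₑ ^ (-s₀) * ENNReal.ofReal (Real.exp (‖z‖ ^ 2 / 4))))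
            ∂(stdGaussian (EuclideanSpace ℝ (Fin d))) := lintegral_mono hpt
      _ = ENNReal.ofReal (c₁ * R ^ (-p)) + ENNReal.ofReal (c₂ * R ^ (-p)) * ∫⁻ z,
            (‖z + w‖ₑ ^ (-s₀) * ENNReal.ofReal (Real.exp (‖z‖ ^ 2 / 4)))
            ∂(stdGaussian (EuclideanSpace ℝ (Fin d))) := by
          rw [lintegral_add_left measurable_const, lintegral_const_mul _ (by fun_prop)]
          simp
      _ ≤ ENNReal.ofReal (c₁ * R ^ (-p)) + ENNReal.ofReal (c₂ * R ^ (-p)) * J := by gcongr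
      _ = (ENNReal.ofReal c₁ + ENNReal.ofReal c₂ * J) * ENNReal.ofReal (R ^ (-p)) := by
          rw [ENNReal.ofReal_mul hc₁, ENNReal.ofReal_mul hc₂]
          ring
      _ ≤ _ := mul_le_mul' le_add_self le_rfl

/-! ### Expected energy of the graph -/

/-- Supplies the joint measurability in (t, ω) that Tonelli needs. Paths are set to 0 on a
measurable null set; elsewhere each value is a limit of measurable representatives along a countable
dense set of times. -/
theorem exists_continuous_measurable_modification {T Ω F : Type*} [TopologicalSpace T]
    [FrechetUrysohnSpace T] [TopologicalSpace.SeparableSpace T] [Nonempty T] [MeasurableSpace Ω]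
    {P : Measure Ω} [TopologicalSpace F] [TopologicalSpace.PseudoMetrizableSpace F] [Zero F]
    [MeasurableSpace F] [BorelSpace F] {B : T → Ω → F} (hB : ∀ t, AEMeasurable (B t) P)
    (hc : ∀ᵐ ω ∂P, Continuous fun t ↦ B t ω) :
    ∃ X : T → Ω → F, (∀ ω, Continuous fun t ↦ X t ω) ∧ (∀ t, Measurable (X t)) ∧
      ∀ᵐ ω ∂P, ∀ t, X t ω = B t ω := by
  classical
  set D := TopologicalSpace.denseSeq T
  have hev : ∀ᵐ ω ∂P, (Continuous fun t ↦ B t ω) ∧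
      ∀ n, B (D n) ω = (hB (D n)).mk _ ω := by
    filter_upwards [hc, ae_all_iff.2 fun n ↦ (hB (D n)).ae_eq_mk] with ω h1 h2 using ⟨h1, h2⟩
  obtain ⟨N, hN, hNm, hN0⟩ := exists_measurable_superset_of_null (ae_iff.1 hev)
  have hgood {ω} (hω : ω ∉ N) : (Continuous fun t ↦ B t ω) ∧
      ∀ n, B (D n) ω = (hB (D n)).mk _ ω := by
    by_contra h
    exact hω (hN h)
  refine ⟨fun t ω ↦ if ω ∈ N then 0 else B t ω, fun ω ↦ ?_, fun t ↦ ?_, ?_⟩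
  · by_cases hω : ω ∈ N
    · simpa [hω] using continuous_const
    · simpa [hω] using (hgood hω).1
  · obtain ⟨x, hx, hxt⟩ := mem_closure_iff_seq_limit.1
      ((TopologicalSpace.denseRange_denseSeq T).closure_range ▸ Set.mem_univ t)
    choose n hn using hx
    refine measurable_of_tendsto_metrizable
      (f := fun k ω ↦ if ω ∈ N then 0 else (hB (D (n k))).mk _ ω) (fun k ↦ ?_) ?_
    · exact Measurable.ite hNm measurable_const (hB (D (n k))).measurable_mk
    · rw [tendsto_pi_nhds]
      intro ω
      by_cases hω : ω ∈ N
      · simpa [hω] using tendsto_const_nhds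
      · simp only [hω, if_false]
        have h1 := ((hgood hω).1.tendsto t).comp hxt
        refine h1.congr fun k ↦ ?_
        rw [← (hgood hω).2 (n k), Function.comp_apply, ← hn k]
  · filter_upwards [measure_eq_zero_iff_ae_notMem.1 hN0] with ω hω t
    simp [hω]

/-- The parabolic gauge `max(|t - u|, ‖f t - f u‖²)` on the graph of `f`. -/
noncomputable def parabolicGauge {d : ℕ} (f : I → EuclideanSpace ℝ (Fin d)) (t u : I) : ℝ≥0∞ :=
  ENNReal.ofReal (max |(t : ℝ) - u| (‖f t - f u‖ ^ 2))

theorem measurable_parabolicGauge {d : ℕ} {f : I → EuclideanSpace ℝ (Fin d)} (hf : Continuous f)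
    (t : I) : Measurable (parabolicGauge f t) := by
  unfold parabolicGauge
  have : Continuous fun u : I ↦ max |(t : ℝ) - u| (‖f t - f u‖ ^ 2) := by fun_prop
  exact this.measurable.ennreal_ofReal

theorem IsStandardBrownianMotion.aemeasurable {Ω : Type*} [MeasurableSpace Ω] {d : ℕ}
    {B : I → Ω → EuclideanSpace ℝ (Fin d)} {P : Measure Ω} (hB : IsStandardBrownianMotion B P)
    (t : I) : AEMeasurable (B t) P := by
  refine (hB.law 0 t unitInterval.nonneg').aemeasurable.congr ?_
  filter_upwards [hB.start] with ω hω
  simp [hω]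

theorem ofReal_max_le_edist_toLp {d : ℕ} (t u : ℝ) (x y : EuclideanSpace ℝ (Fin d)) :
    ENNReal.ofReal (max |t - u| ‖x - y‖) ≤
      edist (WithLp.toLp 2 (t, x)) (WithLp.toLp 2 (u, y)) := by
  rw [edist_dist, dist_eq_norm]
  apply ENNReal.ofReal_le_ofReal
  have h := WithLp.prod_norm_sq_eq_of_L2 (WithLp.toLp 2 (t, x) - WithLp.toLp 2 (u, y))
  simp only [WithLp.sub_fst, WithLp.sub_snd, Real.norm_eq_abs] at h
  refine max_le ?_ ?_ <;> refine abs_le_of_sq_le_sq' ?_ (norm_nonneg _) |>.2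
  · rw [h]; exact le_add_of_nonneg_right (sq_nonneg _)
  · rw [h]; exact le_add_of_nonneg_left (sq_nonneg _)

theorem lintegral_kernel_increment_eq {Ω : Type*} [MeasurableSpace Ω] {d : ℕ}
    {B : I → Ω → EuclideanSpace ℝ (Fin d)} {P : Measure Ω} (hB : IsStandardBrownianMotion B P)
    {u t : I} (hut : u ≤ t) (y : EuclideanSpace ℝ (Fin d)) (s : ℝ) :
    ∫⁻ ω, ENNReal.ofReal ((max ((t : ℝ) - u) ‖B t ω - B u ω + y‖) ^ (-s)) ∂P =
      ∫⁻ z, ENNReal.ofReal ((max ((t : ℝ) - u) ‖√((t : ℝ) - u) • z + y‖) ^ (-s))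
        ∂(stdGaussian (EuclideanSpace ℝ (Fin d))) := by
  have hm : Measurable fun x : EuclideanSpace ℝ (Fin d) ↦
      ENNReal.ofReal ((max ((t : ℝ) - u) ‖x + y‖) ^ (-s)) := by fun_prop
  rw [(hB.law u t hut).lintegral_comp hm.aemeasurable, lintegral_map hm (by fun_prop)]

theorem exists_lintegral_kernel_graph_le {Ω : Type*} [MeasurableSpace Ω] {d : ℕ}
    {B : I → Ω → EuclideanSpace ℝ (Fin d)} {P : Measure Ω} (hB : IsStandardBrownianMotion B P)
    {f : I → EuclideanSpace ℝ (Fin d)} (hf : Continuous f) {s s₀ : ℝ} (hs₀ : 0 < s₀) (hd : s₀ < d)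
    (hs : s₀ ≤ s) :
    ∃ K : ℝ≥0∞, K ≠ ∞ ∧ ∀ t u : I,
      ∫⁻ ω, edist (WithLp.toLp 2 ((t : ℝ), B t ω + f t))
        (WithLp.toLp 2 ((u : ℝ), B u ω + f u)) ^ (-s) ∂P ≤
        K * parabolicGauge f t u ^ (-(s - s₀ / 2)) := by
  obtain ⟨M, hM⟩ : ∃ M : ℝ, ∀ t u : I, ‖f t - f u‖ ^ 2 ≤ M := by
    obtain ⟨M, hM⟩ := (isCompact_range
      (show Continuous fun p : I × I ↦ ‖f p.1 - f p.2‖ ^ 2 by fun_prop)).bddAbove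
    exact ⟨M, fun t u ↦ hM ⟨(t, u), rfl⟩⟩
  obtain ⟨K, hK, hKle⟩ := exists_lintegral_stdGaussian_kernel_le hs₀ hd hs
    (M := max M 1) (by positivity)
  have hsym (t u : I) : parabolicGauge f t u = parabolicGauge f u t := by
    simp only [parabolicGauge, abs_sub_comm (t : ℝ), norm_sub_rev (f t)]
  have hlt (t u : I) (hut : u < t) :
      ∫⁻ ω, edist (WithLp.toLp 2 ((t : ℝ), B t ω + f t))
        (WithLp.toLp 2 ((u : ℝ), B u ω + f u)) ^ (-s) ∂P ≤
        (K + 1) * parabolicGauge f t u ^ (-(s - s₀ / 2)) := by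
    have hτ : 0 < (t : ℝ) - u := sub_pos.2 hut
    calc _ ≤ ∫⁻ ω, ENNReal.ofReal
            ((max ((t : ℝ) - u) ‖B t ω - B u ω + (f t - f u)‖) ^ (-s)) ∂P := by
          refine lintegral_mono fun ω ↦ ?_
          rw [← ENNReal.ofReal_rpow_of_pos (lt_max_of_lt_left hτ), ENNReal.rpow_neg,
            ENNReal.rpow_neg]
          refine ENNReal.inv_le_inv.2 (ENNReal.rpow_le_rpow ?_ (by linarith))
          have h := ofReal_max_le_edist_toLp (t : ℝ) u (B t ω + f t) (B u ω + f u)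
          rwa [abs_of_pos hτ, add_sub_add_comm] at h
      _ ≤ K * ENNReal.ofReal ((max ((t : ℝ) - u) (‖f t - f u‖ ^ 2)) ^ (-(s - s₀ / 2))) := by
          rw [lintegral_kernel_increment_eq hB hut.le]
          exact hKle _ _ hτ ((hM t u).trans (le_max_left _ _))
      _ ≤ _ := by
          rw [← ENNReal.ofReal_rpow_of_pos (lt_max_of_lt_left hτ), parabolicGauge, abs_of_pos hτ]
          exact mul_le_mul' le_self_add le_rfl
  -- On the diagonal the right side must be ∞; the added 1 keeps the constant nonzero so that its
  -- product with 0^(-p) = ∞ is ∞.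
  refine ⟨K + 1, by finiteness, fun t u ↦ ?_⟩
  rcases lt_trichotomy t u with h | h | h
  · rw [hsym]
    simp_rw [edist_comm (WithLp.toLp 2 ((t : ℝ), _))]
    exact hlt u t h
  · have h0 : parabolicGauge f t u = 0 := by simp [parabolicGauge, h]
    rw [h0, ENNReal.zero_rpow_of_neg (by linarith), ENNReal.mul_top (by simp)]
    exact le_top
  · exact hlt t u h

/-- If a time measure is `a`-regular for the parabolic gauge of the drift, then the graph of
Brownian motion with drift has dimension at least every `s` with `max (s / 2) (s - d / 2) < a`. -/
theorem ae_le_dimH_euclideanGraph {Ω : Type*} [MeasurableSpace Ω] {d : ℕ} (hd : 1 ≤ d)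
    {B : I → Ω → EuclideanSpace ℝ (Fin d)} {P : Measure Ω} [IsProbabilityMeasure P]
    (hB : IsStandardBrownianMotion B P) {f : I → EuclideanSpace ℝ (Fin d)} (hf : Continuous f)
    (ν : Measure I) [IsProbabilityMeasure ν] {C : ℝ≥0∞} (hC : C ≠ ∞) {a : ℝ}
    (hν : ∀ (t : I) (k : ℕ), ν {u | parabolicGauge f t u ≤ 2⁻¹ ^ k} ≤ C * (2⁻¹ ^ k) ^ a)
    {s : NNReal} (hs : 0 < s) (hs1 : (s : ℝ) / 2 < a) (hs2 : s - (d : ℝ) / 2 < a) :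
    ∀ᵐ ω ∂P, (s : ℝ≥0∞) ≤ dimH (euclideanGraph fun t ↦ B t ω + f t) := by
  have hd' : (1 : ℝ) ≤ d := by exact_mod_cast hd
  have hs' : (0 : ℝ) < s := hs
  -- For s ≥ d, s₀ lies below d by at most the gap a - (s - d/2), half of which is lost in the
  -- exponent; the cap d/2 keeps s₀ positive.
  obtain ⟨s₀, hs₀, hs₀d, hs₀s, hba⟩ :
      ∃ s₀ : ℝ, 0 < s₀ ∧ s₀ < d ∧ s₀ ≤ s ∧ (s : ℝ) - s₀ / 2 < a := by
    rcases lt_or_ge (s : ℝ) d with h | h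
    · exact ⟨s, hs', h, le_rfl, by linarith⟩
    · refine ⟨d - min ((d : ℝ) / 2) (a - (s - (d : ℝ) / 2)), ?_, ?_, ?_, ?_⟩
      · linarith [min_le_left ((d : ℝ) / 2) (a - (s - (d : ℝ) / 2))]
      · linarith [lt_min (show 0 < (d : ℝ) / 2 by linarith) (sub_pos.2 hs2)]
      · linarith [lt_min (show 0 < (d : ℝ) / 2 by linarith) (sub_pos.2 hs2)]
      · linarith [min_le_right ((d : ℝ) / 2) (a - (s - (d : ℝ) / 2))]
  have hb : 0 < (s : ℝ) - s₀ / 2 := by linarith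
  obtain ⟨K, hK, hKle⟩ := exists_lintegral_kernel_graph_le hB hf hs₀ hs₀d hs₀s
  obtain ⟨X, hXc, hXm, hXB⟩ := exists_continuous_measurable_modification hB.aemeasurable hB.cont
  set γ : Ω → I → WithLp 2 (ℝ × EuclideanSpace ℝ (Fin d)) :=
    fun ω t ↦ WithLp.toLp 2 ((t : ℝ), X t ω + f t) with hγ
  have hγc (ω : Ω) : Continuous (γ ω) := by
    have := hXc ω
    fun_prop
  have hγm : Measurable fun p : Ω × I ↦ γ p.1 p.2 := by
    have h1 := (measurable_uncurry_of_continuous_of_measurable hXc hXm).comp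
      (measurable_swap (α := Ω) (β := I))
    have h2 : Measurable fun p : Ω × I ↦ X p.2 p.1 := h1
    have h3 := hf.measurable
    exact (WithLp.measurable_toLp 2 _).comp
      ((measurable_subtype_coe.comp measurable_snd).prodMk (h2.add (h3.comp measurable_snd)))
  have hF : Measurable fun q : Ω × (I × I) ↦ edist (γ q.1 q.2.1) (γ q.1 q.2.2) ^ (-(s : ℝ)) := by
    have h1 : Measurable fun q : Ω × (I × I) ↦ γ q.1 q.2.1 :=
      hγm.comp (measurable_fst.prodMk (measurable_fst.comp measurable_snd))
    have h2 : Measurable fun q : Ω × (I × I) ↦ γ q.1 q.2.2 :=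
      hγm.comp (measurable_fst.prodMk (measurable_snd.comp measurable_snd))
    exact (h1.edist h2).pow_const _
  set J := ν Set.univ + C * (2 ^ ((s : ℝ) - s₀ / 2) * (1 - 2 ^ ((s : ℝ) - s₀ / 2 - a))⁻¹)
  have hJ : J ≠ ∞ := ENNReal.add_ne_top.2 ⟨measure_ne_top _ _,
    ENNReal.mul_ne_top hC (two_rpow_mul_inv_one_sub_ne_top hba)⟩
  have hint : ∫⁻ ω, ∫⁻ p : I × I, edist (γ ω p.1) (γ ω p.2) ^ (-(s : ℝ)) ∂(ν.prod ν) ∂P ≠ ∞ := by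
    rw [lintegral_lintegral_swap hF.aemeasurable]
    refine ne_top_of_le_ne_top (ENNReal.mul_ne_top hK hJ) ?_
    calc ∫⁻ p : I × I, ∫⁻ ω, edist (γ ω p.1) (γ ω p.2) ^ (-(s : ℝ)) ∂P ∂(ν.prod ν)
        = ∫⁻ t, ∫⁻ u, ∫⁻ ω, edist (γ ω t) (γ ω u) ^ (-(s : ℝ)) ∂P ∂ν ∂ν := by
          rw [lintegral_prod]
          exact (hF.lintegral_prod_left').aemeasurable
      _ ≤ ∫⁻ _t, K * J ∂ν := by
          refine lintegral_mono fun t ↦ ?_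
          calc _ ≤ ∫⁻ u, K * parabolicGauge f t u ^ (-((s : ℝ) - s₀ / 2)) ∂ν := by
                refine lintegral_mono fun u ↦ ?_
                refine le_trans (le_of_eq (lintegral_congr_ae ?_)) (hKle t u)
                filter_upwards [hXB] with ω hω
                simp only [hγ, hω]
            _ = K * ∫⁻ u, parabolicGauge f t u ^ (-((s : ℝ) - s₀ / 2)) ∂ν :=
                lintegral_const_mul _ ((measurable_parabolicGauge hf t).pow_const _)
            _ ≤ K * J := by
                gcongr
                exact lintegral_rpow_neg_le ν (measurable_parabolicGauge hf t) hb (hν t)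
      _ = K * J := by simp
  have hae := ae_lt_top hF.lintegral_prod_right' hint
  filter_upwards [hae, hXB] with ω hω hXω
  have hgraph : euclideanGraph (fun t ↦ B t ω + f t) = Set.range (γ ω) := by
    simp only [euclideanGraph, hγ, hXω]
  rw [hgraph]
  have hγω := (hγc ω).measurable
  have : IsProbabilityMeasure (ν.map (γ ω)) := Measure.isProbabilityMeasure_map hγω.aemeasurable
  refine le_dimH_of_lintegral_edist_rpow_neg_ne_top (ν.map (γ ω)) ?_ hs ?_
  · rw [Measure.map_apply hγω (isCompact_range (hγc ω)).isClosed.measurableSet]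
    simp
  · rw [lintegral_prod _ (by
      exact (hF.comp (measurable_const (a := ω) |>.prodMk measurable_id)).aemeasurable)] at hω
    rw [lintegral_map (Measurable.lintegral_prod_right' (f := fun p :
      WithLp 2 (ℝ × EuclideanSpace ℝ (Fin d)) × WithLp 2 (ℝ × EuclideanSpace ℝ (Fin d)) ↦
        edist p.1 p.2 ^ (-(s : ℝ))) (by fun_prop)) hγω]
    refine ne_of_lt (lt_of_le_of_lt (le_of_eq ?_) hω)
    refine lintegral_congr fun t ↦ ?_
    rw [lintegral_map (by fun_prop) hγω]

/-! ### Frostman measures on a tree of partitions -/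

/-- A tree-indexed mass distribution dominated by an outer measure: at each node the mass is split
among the children in proportion to their outer measures. -/
theorem exists_tree_mass_le_outerMeasure {X κ : Type*} [Countable κ] (h : OuterMeasure X)
    (c : ℕ → X → κ) (p : κ → κ) (hp : ∀ k x, p (c (k + 1) x) = c k x)
    (hfin : ∀ q, (p ⁻¹' {q}).Finite) (hle : ∀ k q, h (c k ⁻¹' {q}) ≠ ∞)
    (hne : h Set.univ ≠ 0) :
    ∃ w : ℕ → κ → ℝ≥0∞, (∀ k q, w k q ≤ h (c k ⁻¹' {q})) ∧
      (∀ k q, ∑' q' : p ⁻¹' {q}, w (k + 1) q' = w k q) ∧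
      ∑' q, w 0 q ≠ 0 ∧ ∑' q, w 0 q ≠ ∞ := by
  classical
  -- There may be infinitely many roots; putting all the mass on one that is charged makes the total
  -- finite and nonzero.
  obtain ⟨q₀, hq₀⟩ : ∃ q₀, h (c 0 ⁻¹' {q₀}) ≠ 0 := by
    by_contra! hcon
    apply hne
    have : (Set.univ : Set X) = ⋃ q, c 0 ⁻¹' {q} := by ext x; simp
    rw [this, measure_iUnion_null_iff]
    exact hcon
  set S : ℕ → κ → ℝ≥0∞ := fun k q ↦ ∑' q' : p ⁻¹' {q}, h (c (k + 1) ⁻¹' {(q' : κ)}) with hS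
  have hsub (k : ℕ) (q : κ) : h (c k ⁻¹' {q}) ≤ S k q := by
    have : Countable (p ⁻¹' {q}) := Subtype.countable
    refine le_trans (measure_mono fun x hx ↦ ?_) (measure_iUnion_le _)
    simp only [Set.mem_preimage, Set.mem_singleton_iff] at hx
    exact Set.mem_iUnion.2 ⟨⟨c (k + 1) x, by simp [hp, hx]⟩, by simp⟩
  have hStop (k : ℕ) (q : κ) : S k q ≠ ∞ := by
    have := (hfin q).fintype
    simp only [hS, tsum_fintype]
    exact ENNReal.sum_ne_top.2 fun q' _ ↦ hle _ _
  set w : ℕ → κ → ℝ≥0∞ := fun k ↦ Nat.rec (Pi.single q₀ (h (c 0 ⁻¹' {q₀})))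
    (fun k v q ↦ v (p q) * (h (c (k + 1) ⁻¹' {q}) / S k (p q))) k
  have hw0 : w 0 = Pi.single q₀ (h (c 0 ⁻¹' {q₀})) := rfl
  have hws (k : ℕ) (q : κ) :
      w (k + 1) q = w k (p q) * (h (c (k + 1) ⁻¹' {q}) / S k (p q)) := rfl
  have hwle : ∀ k q, w k q ≤ h (c k ⁻¹' {q}) := by
    intro k
    induction k with
    | zero =>
      intro q
      rw [hw0]
      rcases eq_or_ne q q₀ with rfl | hq
      · simp
      · simp [hq]
    | succ k ih =>
      intro q
      rw [hws, ← mul_div_assoc]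
      refine ENNReal.div_le_of_le_mul ?_
      rw [mul_comm]
      exact mul_le_mul' le_rfl ((ih _).trans (hsub _ _))
  refine ⟨w, hwle, fun k q ↦ ?_, ?_, ?_⟩
  · have e (q' : p ⁻¹' {q}) : w (k + 1) q' = w k q * (h (c (k + 1) ⁻¹' {(q' : κ)}) / S k q) := by
      rw [hws, q'.2]
    simp_rw [e, ENNReal.tsum_mul_left, div_eq_mul_inv, ENNReal.tsum_mul_right]
    -- If all children are null then, by subadditivity, so is the node, and there is no mass to
    -- split.
    rcases eq_or_ne (S k q) 0 with h0 | h0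
    · have : w k q = 0 := le_antisymm (((hwle k q).trans (hsub k q)).trans h0.le) zero_le
      rw [this, zero_mul]
    · change w k q * (S k q * (S k q)⁻¹) = _
      rw [ENNReal.mul_inv_cancel h0 (hStop k q), mul_one]
  · rw [hw0, tsum_pi_single]; exact hq₀
  · rw [hw0, tsum_pi_single]; exact hle _ _

/-- **Frostman's lemma** along a nested sequence of partitions of a compact space. -/
theorem exists_probabilityMeasure_le_outerMeasure {X κ : Type*} [TopologicalSpace X]
    [CompactSpace X] [TopologicalSpace.MetrizableSpace X] [MeasurableSpace X] [BorelSpace X]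
    [Countable κ] (h : OuterMeasure X) (c : ℕ → X → κ) (p : κ → κ)
    (hp : ∀ k x, p (c (k + 1) x) = c k x) (hfin : ∀ q, (p ⁻¹' {q}).Finite) {G : ℕ → ℝ≥0∞}
    (hG : ∀ k, G k ≠ ∞) (hle : ∀ k q, h (c k ⁻¹' {q}) ≤ G k) (hne : h Set.univ ≠ 0) :
    ∃ ν : ProbabilityMeasure X, ∃ C : ℝ≥0∞, C ≠ ∞ ∧ ∀ (k : ℕ) (U : Set X) (F : Finset κ),
      IsOpen U → (∀ x ∈ U, c k x ∈ F) → (ν : Measure X) U ≤ C * (F.card * G k) := by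
  classical
  obtain ⟨w, hwle, hwsum, hw0, hwtop⟩ := exists_tree_mass_le_outerMeasure h c p hp hfin
    (fun k q ↦ ne_top_of_le_ne_top (hG k) (hle k q)) hne
  set m := ∑' q, w 0 q
  -- Conservation of mass: summing over level k + j a function of the level-k ancestor gives its sum
  -- over level k.
  have hanc (k j : ℕ) (g : κ → ℝ≥0∞) :
      ∑' q, w (k + j) q * g (p^[j] q) = ∑' q, w k q * g q := by
    induction j with
    | zero => simp
    | succ j ih =>
      rw [← ih, ← ENNReal.tsum_fiberwise _ p]
      refine tsum_congr fun q ↦ ?_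
      have e (q' : p ⁻¹' {q}) : w (k + (j + 1)) q' * g (p^[j + 1] q') =
          w (k + j + 1) q' * g (p^[j] q) := by
        rw [Function.iterate_succ_apply, q'.2]; rfl
      simp_rw [e, ENNReal.tsum_mul_right, hwsum]
  have hcanc (k j : ℕ) (x : X) : p^[j] (c (k + j) x) = c k x := by
    induction j with
    | zero => rfl
    | succ j ih => rw [Function.iterate_succ_apply, ← add_assoc, hp, ih]
  have hX : Nonempty X := by
    by_contra hX
    rw [not_nonempty_iff] at hX
    exact hne (by rw [Set.univ_eq_empty_iff.2 hX, measure_empty])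
  have hpt (n : ℕ) (q : κ) : ∃ x : X, w n q ≠ 0 → c n x = q := by
    rcases (c n ⁻¹' {q}).eq_empty_or_nonempty with he | ⟨x, hx⟩
    · refine ⟨hX.some, fun hw ↦ absurd ?_ hw⟩
      have := hwle n q
      rwa [he, measure_empty, nonpos_iff_eq_zero] at this
    · exact ⟨x, fun _ ↦ hx⟩
  choose pt hpt using hpt
  set μ : ℕ → Measure X := fun n ↦ Measure.sum fun q ↦ (m⁻¹ * w n q) • Measure.dirac (pt n q)
  have hμ (n : ℕ) {U : Set X} (hU : MeasurableSet U) :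
      μ n U = m⁻¹ * ∑' q, w n q * U.indicator 1 (pt n q) := by
    simp only [μ, Measure.sum_apply _ hU, Measure.smul_apply, smul_eq_mul,
      Measure.dirac_apply' _ hU, mul_assoc, ENNReal.tsum_mul_left]
  have hprob (n : ℕ) : IsProbabilityMeasure (μ n) := by
    refine ⟨?_⟩
    rw [hμ n MeasurableSet.univ]
    have := hanc 0 n 1
    simp only [zero_add, Pi.one_apply, mul_one] at this
    simp only [Set.indicator_univ, Pi.one_apply, mul_one, this]
    exact ENNReal.inv_mul_cancel hw0 hwtop
  have hbound (k n : ℕ) (hkn : k ≤ n) (U : Set X) (F : Finset κ) (hU : IsOpen U)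
      (hUF : ∀ x ∈ U, c k x ∈ F) : μ n U ≤ m⁻¹ * (F.card * G k) := by
    obtain ⟨j, rfl⟩ := Nat.exists_eq_add_of_le hkn
    rw [hμ _ hU.measurableSet]
    gcongr
    calc _ ≤ ∑' q, w (k + j) q * (F : Set κ).indicator 1 (p^[j] q) := by
          refine ENNReal.tsum_le_tsum fun q ↦ ?_
          rcases eq_or_ne (w (k + j) q) 0 with h0 | h0
          · simp [h0]
          gcongr
          by_cases hx : pt (k + j) q ∈ U
          · have := hUF _ hx
            rw [← hcanc k j, hpt _ _ h0] at this
            rw [Set.indicator_of_mem hx, Set.indicator_of_mem (by exact_mod_cast this)]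
            rfl
          · simp [hx]
      _ = ∑' q, w k q * (F : Set κ).indicator 1 q := hanc k j _
      _ = ∑ q ∈ F, w k q := by
          rw [tsum_eq_sum (s := F)]
          · refine Finset.sum_congr rfl fun q hq ↦ ?_
            simp [hq]
          · intro q hq
            simp [hq]
      _ ≤ ∑ _q ∈ F, G k := Finset.sum_le_sum fun q _ ↦ (hwle k q).trans (hle k q)
      _ = F.card * G k := by simp
  set μP : ℕ → ProbabilityMeasure X := fun n ↦ ⟨μ n, hprob n⟩
  set L : Ultrafilter ℕ := Filter.hyperfilter ℕ
  obtain ⟨ν, hν⟩ : ∃ ν, Filter.Tendsto μP L (nhds ν) := ⟨_, (L.map μP).le_nhds_lim⟩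
  refine ⟨ν, m⁻¹, ENNReal.inv_ne_top.2 hw0, fun k U F hU hUF ↦ ?_⟩
  -- Mass on open sets is lower semicontinuous under weak limits, so the bounds on the discrete
  -- measures survive for open `U`.
  refine (ProbabilityMeasure.le_liminf_measure_open_of_tendsto hν hU).trans ?_
  refine Filter.liminf_le_of_frequently_le' (Filter.Eventually.frequently ?_)
  have : ∀ᶠ n in Filter.atTop, (μP n : Measure X) U ≤ m⁻¹ * (F.card * G k) := by
    filter_upwards [Filter.eventually_ge_atTop k] with n hn using hbound k n hn U F hU hUF
  exact Nat.hyperfilter_le_atTop this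

/-! ### Parabolic boxes and their Hausdorff content -/

/-- Index of the parabolic dyadic box, of size `4⁻ᵏ` in time and `2⁻ᵏ` in space, that contains
the point of the graph of `f` at time `t`. -/
noncomputable def parabolicIndex {d : ℕ} (f : I → EuclideanSpace ℝ (Fin d)) (k : ℕ) (t : I) :
    ℤ × (Fin d → ℤ) :=
  (⌊(4 : ℝ) ^ k * t⌋, fun i ↦ ⌊(2 : ℝ) ^ k * f t i⌋)

/-- Index of the parent of a parabolic dyadic box. -/
def parabolicParent {d : ℕ} (q : ℤ × (Fin d → ℤ)) : ℤ × (Fin d → ℤ) :=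
  (q.1 / 4, fun i ↦ q.2 i / 2)

theorem parabolicParent_parabolicIndex {d : ℕ} (f : I → EuclideanSpace ℝ (Fin d)) (k : ℕ)
    (t : I) : parabolicParent (parabolicIndex f (k + 1) t) = parabolicIndex f k t := by
  simp only [parabolicParent, parabolicIndex, Prod.mk.injEq]
  refine ⟨?_, funext fun i ↦ ?_⟩
  · rw [show (4 : ℤ) = ((4 : ℕ) : ℤ) from rfl, ← Int.floor_div_natCast]
    congr 1; push_cast; ring
  · rw [show (2 : ℤ) = ((2 : ℕ) : ℤ) from rfl, ← Int.floor_div_natCast]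
    congr 1; push_cast; ring

theorem finite_parabolicParent_fiber {d : ℕ} (q : ℤ × (Fin d → ℤ)) :
    (parabolicParent ⁻¹' {q}).Finite := by
  refine ((Set.finite_Icc (4 * q.1) (4 * q.1 + 3)).prod
    (Set.finite_Icc (fun i ↦ 2 * q.2 i) (fun i ↦ 2 * q.2 i + 1))).subset ?_
  rintro q' rfl
  simp only [parabolicParent, Set.mem_prod, Set.mem_Icc, Pi.le_def]
  exact ⟨⟨by lia, by lia⟩, fun i ↦ by lia, fun i ↦ by lia⟩

theorem abs_sub_le_of_floor_eq {x y c : ℝ} (hc : 0 < c) (h : ⌊c * x⌋ = ⌊c * y⌋) :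
    |x - y| ≤ c⁻¹ := by
  have h1 := Int.abs_sub_lt_one_of_floor_eq_floor h
  rw [← mul_sub, abs_mul, abs_of_pos hc] at h1
  rw [← one_div, le_div_iff₀ hc]
  linarith

theorem edist_toLp_le_of_forall_abs_sub_le {d : ℕ} {t u ε : ℝ} {x y : EuclideanSpace ℝ (Fin d)}
    (ht : |t - u| ≤ ε) (hx : ∀ i, |x i - y i| ≤ ε) :
    edist (WithLp.toLp 2 (t, x)) (WithLp.toLp 2 (u, y)) ≤ (d + 1) * ENNReal.ofReal ε := by
  have hε : 0 ≤ ε := (abs_nonneg _).trans ht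
  rw [edist_dist, dist_eq_norm]
  have h := WithLp.prod_norm_sq_eq_of_L2 (WithLp.toLp 2 (t, x) - WithLp.toLp 2 (u, y))
  replace h : ‖WithLp.toLp 2 (t, x) - WithLp.toLp 2 (u, y)‖ ^ 2 = |t - u| ^ 2 + ‖x - y‖ ^ 2 := h
  have h1 : ‖x - y‖ ^ 2 ≤ d * ε ^ 2 := by
    rw [EuclideanSpace.norm_sq_eq]
    calc _ ≤ ∑ _i : Fin d, ε ^ 2 := Finset.sum_le_sum fun i _ ↦
          pow_le_pow_left₀ (norm_nonneg _) (by simpa using hx i) 2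
      _ = _ := by simp
  have h2 : |t - u| ^ 2 ≤ ε ^ 2 := pow_le_pow_left₀ (abs_nonneg _) ht 2
  have h3 : ‖WithLp.toLp 2 (t, x) - WithLp.toLp 2 (u, y)‖ ≤ (d + 1) * ε := by
    refine abs_le_of_sq_le_sq' ?_ (by positivity) |>.2
    rw [h]
    nlinarith [mul_nonneg (Nat.cast_nonneg (α := ℝ) d) (sq_nonneg ε),
      mul_nonneg (sq_nonneg (d : ℝ)) (sq_nonneg ε)]
  refine (ENNReal.ofReal_le_ofReal h3).trans_eq ?_
  rw [ENNReal.ofReal_mul (by positivity), ENNReal.ofReal_add (by positivity) (by positivity)]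
  simp

theorem ENNReal.ofReal_inv_pow {c : ℝ} (hc : 0 < c) (k : ℕ) :
    ENNReal.ofReal ((c ^ k)⁻¹) = (ENNReal.ofReal c)⁻¹ ^ k := by
  rw [ENNReal.ofReal_inv_of_pos (by positivity), ENNReal.ofReal_pow hc.le, ENNReal.inv_pow]

/-- A parabolic box is either one Euclidean ball of radius of order `2⁻ᵏ`, or a union of `2^(k d)`
balls of radius of order `4⁻ᵏ`. -/
theorem mkMetric_pre_graph_image_le {d : ℕ} (f : I → EuclideanSpace ℝ (Fin d)) {s : ℝ}
    (hs : 0 < s) {r : ℝ≥0∞} {k : ℕ} (hk : (d + 1) * (2 : ℝ≥0∞)⁻¹ ^ k ≤ r)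
    (q : ℤ × (Fin d → ℤ)) :
    OuterMeasure.mkMetric'.pre (fun S ↦ Metric.ediam S ^ s) r
        ((fun t : I ↦ WithLp.toLp 2 ((t : ℝ), f t)) '' (parabolicIndex f k ⁻¹' {q})) ≤
      (d + 1) ^ s * ((4 : ℝ≥0∞)⁻¹ ^ k) ^ (max (s / 2) (s - d / 2)) := by
  set η : I → WithLp 2 (ℝ × EuclideanSpace ℝ (Fin d)) :=
    fun t : I ↦ WithLp.toLp 2 ((t : ℝ), f t) with hη
  have h42 : (4 : ℝ≥0∞)⁻¹ ^ k = (2⁻¹ ^ k) ^ (2 : ℝ) := by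
    rw [show (4 : ℝ≥0∞) = 2 ^ 2 by norm_num, ENNReal.rpow_two, ← pow_mul, mul_comm, pow_mul,
      ENNReal.inv_pow]
  have h2ne : (2 : ℝ≥0∞)⁻¹ ^ k ≠ 0 := by simp
  have h2top : (2 : ℝ≥0∞)⁻¹ ^ k ≠ ∞ := by simp
  have h4le : (4 : ℝ≥0∞)⁻¹ ^ k ≤ 2⁻¹ ^ k := by gcongr; norm_num
  have htime {t u : I} (ht : t ∈ parabolicIndex f k ⁻¹' {q}) (hu : u ∈ parabolicIndex f k ⁻¹' {q}) :
      |(t : ℝ) - u| ≤ ((4 : ℝ) ^ k)⁻¹ := by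
    have h1 : parabolicIndex f k t = parabolicIndex f k u := Eq.trans ht (Eq.symm hu)
    exact abs_sub_le_of_floor_eq (by positivity) (congrArg Prod.fst h1)
  have hbig : Metric.ediam (η '' (parabolicIndex f k ⁻¹' {q})) ≤ (d + 1) * (2 : ℝ≥0∞)⁻¹ ^ k := by
    refine Metric.ediam_le ?_
    rintro _ ⟨t, ht, rfl⟩ _ ⟨u, hu, rfl⟩
    have h1 : parabolicIndex f k t = parabolicIndex f k u := Eq.trans ht (Eq.symm hu)
    refine (edist_toLp_le_of_forall_abs_sub_le (ε := ((2 : ℝ) ^ k)⁻¹) ?_ fun i ↦ ?_).trans_eq ?_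
    · refine (htime ht hu).trans ?_
      gcongr; norm_num
    · exact abs_sub_le_of_floor_eq (by positivity) (congrFun (congrArg Prod.snd h1) i)
    · rw [ENNReal.ofReal_inv_pow (by norm_num)]; norm_num
  rcases le_total (s - d / 2) (s / 2) with h | h
  · rw [max_eq_left h]
    calc _ ≤ Metric.ediam (η '' (parabolicIndex f k ⁻¹' {q})) ^ s :=
          OuterMeasure.mkMetric'.pre_le (hbig.trans hk)
      _ ≤ ((d + 1) * (2 : ℝ≥0∞)⁻¹ ^ k) ^ s := ENNReal.rpow_le_rpow hbig hs.le
      _ = _ := by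
        rw [ENNReal.mul_rpow_of_nonneg _ _ hs.le, h42, ← ENNReal.rpow_mul]
        congr 2; ring
  · rw [max_eq_right h]
    -- Cutting each spatial side 2⁻ᵏ into 2ᵏ pieces of length 4⁻ᵏ gives 2^(kd) = (4⁻ᵏ)^(-d/2) cells.
    set F : Finset (Fin d → ℤ) :=
      Fintype.piFinset fun i ↦ Finset.Ico (2 ^ k * q.2 i) (2 ^ k * q.2 i + 2 ^ k) with hF
    set cell : (Fin d → ℤ) → Set I := fun v ↦
      parabolicIndex f k ⁻¹' {q} ∩ {t | (fun i ↦ ⌊(4 : ℝ) ^ k * f t i⌋) = v} with hcell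
    have hcover : η '' (parabolicIndex f k ⁻¹' {q}) ⊆ ⋃ v ∈ F, η '' cell v := by
      rintro _ ⟨t, ht, rfl⟩
      simp only [Set.mem_iUnion]
      refine ⟨fun i ↦ ⌊(4 : ℝ) ^ k * f t i⌋, ?_, t, ⟨ht, rfl⟩, rfl⟩
      rw [hF, Fintype.mem_piFinset]
      intro i
      have h1 : ⌊(2 : ℝ) ^ k * f t i⌋ = q.2 i := by
        have := congrFun (congrArg Prod.snd (show parabolicIndex f k t = q from ht)) i
        exact this
      have h2 : ⌊(4 : ℝ) ^ k * f t i⌋ / ((2 ^ k : ℕ) : ℤ) = q.2 i := by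
        rw [← Int.floor_div_natCast, ← h1]
        congr 1
        rw [show (4 : ℝ) = 2 * 2 by norm_num, mul_pow]
        push_cast
        field_simp
      rw [Finset.mem_Ico, ← h2]
      have hpos : (0 : ℤ) < ((2 ^ k : ℕ) : ℤ) := by positivity
      have h3 := Int.emod_add_mul_ediv ⌊(4 : ℝ) ^ k * f t i⌋ ((2 ^ k : ℕ) : ℤ)
      have h4 := Int.emod_nonneg ⌊(4 : ℝ) ^ k * f t i⌋ hpos.ne'
      have h5 := Int.emod_lt_of_pos ⌊(4 : ℝ) ^ k * f t i⌋ hpos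
      push_cast at h3 h4 h5 ⊢
      constructor <;> linarith
    have hsmall (v : Fin d → ℤ) : Metric.ediam (η '' cell v) ≤ (d + 1) * (4 : ℝ≥0∞)⁻¹ ^ k := by
      refine Metric.ediam_le ?_
      rintro _ ⟨t, ⟨ht, htv⟩, rfl⟩ _ ⟨u, ⟨hu, huv⟩, rfl⟩
      refine (edist_toLp_le_of_forall_abs_sub_le (ε := ((4 : ℝ) ^ k)⁻¹) (htime ht hu)
        fun i ↦ ?_).trans_eq ?_
      · exact abs_sub_le_of_floor_eq (by positivity) (congrFun (Eq.trans htv (Eq.symm huv)) i)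
      · rw [ENNReal.ofReal_inv_pow (by norm_num)]; norm_num
    have hcard : (F.card : ℝ≥0∞) = ((4 : ℝ≥0∞)⁻¹ ^ k) ^ (-((d : ℝ) / 2)) := by
      rw [hF, Fintype.card_piFinset]
      simp only [Int.card_Ico, add_sub_cancel_left, Finset.prod_const, Finset.card_univ,
        Fintype.card_fin]
      rw [show ((2 : ℤ) ^ k).toNat = 2 ^ k by
        rw [show (2 : ℤ) ^ k = ((2 ^ k : ℕ) : ℤ) by push_cast; rfl, Int.toNat_natCast]]
      rw [h42, ← ENNReal.rpow_mul, ← ENNReal.inv_pow, ENNReal.inv_rpow, ← ENNReal.rpow_neg,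
        show -(2 * -((d : ℝ) / 2)) = d by ring, ENNReal.rpow_natCast]
      push_cast; rfl
    calc _ ≤ ∑ v ∈ F, OuterMeasure.mkMetric'.pre (fun S ↦ Metric.ediam S ^ s) r (η '' cell v) :=
          (measure_mono hcover).trans (measure_biUnion_finset_le _ _)
      _ ≤ ∑ _v ∈ F, ((d + 1) * (4 : ℝ≥0∞)⁻¹ ^ k) ^ s := by
          refine Finset.sum_le_sum fun v _ ↦ ?_
          refine (OuterMeasure.mkMetric'.pre_le ((hsmall v).trans (le_trans ?_ hk))).trans
            (ENNReal.rpow_le_rpow (hsmall v) hs.le)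
          gcongr
      _ = (d + 1) ^ s * ((4 : ℝ≥0∞)⁻¹ ^ k) ^ (s - d / 2) := by
          rw [Finset.sum_const, nsmul_eq_mul, hcard, ENNReal.mul_rpow_of_nonneg _ _ hs.le,
            mul_left_comm, ← ENNReal.rpow_add _ _ (by simp) (by simp)]
          congr 2; ring

theorem abs_floor_sub_floor_le_one {x y : ℝ} (h : |x - y| < 1) : |⌊x⌋ - ⌊y⌋| ≤ 1 := by
  rw [abs_sub_lt_iff] at h
  have h1 := Int.floor_le x
  have h2 := Int.lt_floor_add_one x
  have h3 := Int.floor_le y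
  have h4 := Int.lt_floor_add_one y
  have h5 : (⌊x⌋ : ℝ) < ⌊y⌋ + 2 := by linarith
  have h6 : (⌊y⌋ : ℝ) < ⌊x⌋ + 2 := by linarith
  norm_cast at h5 h6
  rw [abs_le]
  constructor <;> lia

/-- A small ball for the parabolic gauge meets boundedly many parabolic boxes. -/
theorem exists_finset_parabolicIndex_mem {d : ℕ} (f : I → EuclideanSpace ℝ (Fin d)) (k : ℕ)
    (t : I) : ∃ F : Finset (ℤ × (Fin d → ℤ)), F.card = 3 ^ (d + 1) ∧
      ∀ u, parabolicGauge f t u < 4⁻¹ ^ k → parabolicIndex f k u ∈ F := by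
  set q := parabolicIndex f k t with hq
  refine ⟨Finset.Icc (q.1 - 1) (q.1 + 1) ×ˢ
    Fintype.piFinset fun i ↦ Finset.Icc (q.2 i - 1) (q.2 i + 1), ?_, fun u hu ↦ ?_⟩
  · rw [Finset.card_product, Fintype.card_piFinset]
    simp only [Int.card_Icc]
    rw [Finset.prod_congr rfl (g := fun _ ↦ 3) (fun i _ ↦ by lia)]
    rw [show (q.1 + 1 + 1 - (q.1 - 1)).toNat = 3 by lia]
    simp [pow_succ, mul_comm]
  · have h4 : (4 : ℝ≥0∞)⁻¹ ^ k = ENNReal.ofReal (((4 : ℝ) ^ k)⁻¹) := by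
      rw [ENNReal.ofReal_inv_pow (by norm_num)]; norm_num
    rw [h4, parabolicGauge, ENNReal.ofReal_lt_ofReal_iff (by positivity), max_lt_iff] at hu
    have key {x y c : ℝ} (hc : 0 < c) (h : |x - y| < c⁻¹) : |⌊c * x⌋ - ⌊c * y⌋| ≤ 1 := by
      apply abs_floor_sub_floor_le_one
      rw [← mul_sub, abs_mul, abs_of_pos hc]
      calc c * |x - y| < c * c⁻¹ := by gcongr
        _ = 1 := mul_inv_cancel₀ hc.ne'
    have hx : ‖f t - f u‖ < ((2 : ℝ) ^ k)⁻¹ := by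
      refine lt_of_pow_lt_pow_left₀ 2 (by positivity) (hu.2.trans_eq ?_)
      rw [inv_pow, ← pow_mul, mul_comm, pow_mul]; norm_num
    rw [Finset.mem_product, Fintype.mem_piFinset]
    refine ⟨?_, fun i ↦ ?_⟩
    · have := abs_le.1 (key (c := (4 : ℝ) ^ k) (by positivity) hu.1)
      rw [Finset.mem_Icc]
      simp only [hq, parabolicIndex]
      constructor <;> lia
    · have hi : |f t i - f u i| < ((2 : ℝ) ^ k)⁻¹ := by
        have := PiLp.norm_apply_le (f t - f u) i
        simp only [PiLp.sub_apply, Real.norm_eq_abs] at this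
        exact this.trans_lt hx
      have := abs_le.1 (key (c := (2 : ℝ) ^ k) (by positivity) hi)
      rw [Finset.mem_Icc]
      simp only [hq, parabolicIndex]
      constructor <;> lia

/-- Hausdorff measure is the supremum of its premeasures. One fixed scale is used since the
Hausdorff measure itself may be infinite on boxes, whereas the premeasure is controlled by explicit
covers. -/
theorem exists_mkMetric_pre_ne_zero {d : ℕ} {f : I → EuclideanSpace ℝ (Fin d)} {s : NNReal}
    (h : (s : ℝ≥0∞) < dimH (euclideanGraph f)) :
    ∃ r : ℝ≥0∞, 0 < r ∧ OuterMeasure.mkMetric'.pre (fun S ↦ Metric.ediam S ^ (s : ℝ)) r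
      (euclideanGraph f) ≠ 0 := by
  have h1 := hausdorffMeasure_of_lt_dimH h
  by_contra! hcon
  rw [Measure.hausdorffMeasure, ← Measure.coe_toOuterMeasure, Measure.mkMetric_toOuterMeasure,
    OuterMeasure.mkMetric, OuterMeasure.mkMetric'] at h1
  simp only [OuterMeasure.iSup_apply] at h1
  have : (⨆ (r : ℝ≥0∞), ⨆ (_ : 0 < r), OuterMeasure.mkMetric'.pre
      (fun S ↦ Metric.ediam S ^ (s : ℝ)) r (euclideanGraph f)) = 0 := by
    simp only [ENNReal.iSup_eq_zero]
    exact hcon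
  rw [this] at h1
  simp at h1

/-- Frostman's lemma for the parabolic gauge on the graph of a continuous function. -/
theorem exists_measure_parabolicGauge_le {d : ℕ} {f : I → EuclideanSpace ℝ (Fin d)}
    (hf : Continuous f) {s : NNReal} (hs : 0 < s) (h : (s : ℝ≥0∞) < dimH (euclideanGraph f)) :
    ∃ ν : ProbabilityMeasure I, ∃ C : ℝ≥0∞, C ≠ ∞ ∧ ∀ (t : I) (k : ℕ),
      (ν : Measure I) {u | parabolicGauge f t u ≤ 2⁻¹ ^ k} ≤
        C * (2⁻¹ ^ k) ^ (max ((s : ℝ) / 2) (s - d / 2)) := by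
  have hs' : (0 : ℝ) < s := hs
  set a := max ((s : ℝ) / 2) (s - d / 2) with ha
  have ha0 : 0 < a := lt_max_of_lt_left (by positivity)
  have hpow {m n : ℕ} (hmn : m ≤ n) : (2 : ℝ≥0∞)⁻¹ ^ n ≤ 2⁻¹ ^ m :=
    pow_le_pow_right_of_le_one' (by norm_num) hmn
  obtain ⟨r, hr, hpre⟩ := exists_mkMetric_pre_ne_zero h
  obtain ⟨N, hN⟩ : ∃ N : ℕ, (d + 1) * (2 : ℝ≥0∞)⁻¹ ^ N ≤ r := by
    have hlim : Filter.Tendsto (fun n : ℕ ↦ ((d : ℝ≥0∞) + 1) * (2 : ℝ≥0∞)⁻¹ ^ n) Filter.atTop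
        (nhds (((d : ℝ≥0∞) + 1) * 0)) :=
      ENNReal.Tendsto.const_mul (ENNReal.tendsto_pow_atTop_nhds_zero_of_lt_one (by norm_num))
        (Or.inr (by finiteness))
    rw [mul_zero] at hlim
    obtain ⟨n, hn⟩ := (hlim.eventually (gt_mem_nhds hr)).exists
    exact ⟨n, hn.le⟩
  set η : I → WithLp 2 (ℝ × EuclideanSpace ℝ (Fin d)) :=
    fun t : I ↦ WithLp.toLp 2 ((t : ℝ), f t) with hη
  -- The tree starts at level `N`, where the covering sets are already small enough to be admissible
  -- for the premeasure at scale `r`.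
  set G : ℕ → ℝ≥0∞ := fun k ↦ (d + 1) ^ (s : ℝ) * ((4 : ℝ≥0∞)⁻¹ ^ (N + k)) ^ a with hG
  have hdtop : ((d : ℝ≥0∞) + 1) ^ (s : ℝ) ≠ ∞ :=
    ENNReal.rpow_ne_top_of_nonneg hs'.le (by finiteness)
  obtain ⟨ν, C, hC, hν⟩ := exists_probabilityMeasure_le_outerMeasure
    (OuterMeasure.comap η (OuterMeasure.mkMetric'.pre (fun S ↦ Metric.ediam S ^ (s : ℝ)) r))
    (fun k ↦ parabolicIndex f (N + k)) parabolicParent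
    (fun k t ↦ parabolicParent_parabolicIndex f (N + k) t) finite_parabolicParent_fiber (G := G)
    (fun k ↦ ENNReal.mul_ne_top hdtop (ENNReal.rpow_ne_top_of_nonneg ha0.le (by simp)))
    (fun k q ↦ by
      rw [OuterMeasure.comap_apply]
      refine mkMetric_pre_graph_image_le f hs' (le_trans ?_ hN) q
      exact mul_le_mul' le_rfl (hpow (Nat.le_add_right N k)))
    (by
      rw [OuterMeasure.comap_apply, Set.image_univ]
      exact hpre)
  set C₁ : ℝ≥0∞ := C * (3 ^ (d + 1) * ((d + 1) ^ (s : ℝ) * 4 ^ a)) with hC₁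
  -- Covers the coarse scales k ≤ 2N, where only the bound ν ≤ 1 is available.
  set C₂ : ℝ≥0∞ := (2 ^ (2 * N)) ^ a with hC₂
  refine ⟨ν, C₁ + C₂, ?_, fun t k ↦ ?_⟩
  · have h1 : (4 : ℝ≥0∞) ^ a ≠ ∞ := ENNReal.rpow_ne_top_of_nonneg ha0.le (by simp)
    have h2 : C₂ ≠ ∞ := ENNReal.rpow_ne_top_of_nonneg ha0.le (by simp)
    have h3 : C₁ ≠ ∞ := by finiteness
    finiteness
  rcases le_or_gt k (2 * N) with hk | hk
  · calc _ ≤ (1 : ℝ≥0∞) := prob_le_one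
      _ ≤ C₂ * (2⁻¹ ^ k) ^ a := by
        rw [hC₂, ← ENNReal.mul_rpow_of_nonneg _ _ ha0.le]
        refine ENNReal.one_le_rpow ?_ ha0
        calc (1 : ℝ≥0∞) = 2 ^ k * 2⁻¹ ^ k := by
              rw [← mul_pow, ENNReal.mul_inv_cancel (by simp) (by simp), one_pow]
          _ ≤ 2 ^ (2 * N) * 2⁻¹ ^ k := by gcongr; norm_num
      _ ≤ _ := mul_le_mul' le_add_self le_rfl
  -- The strict inequality puts the closed gauge ball inside an open one of radius 4^(-(N+j)), at
  -- the cost of a factor of at most 4 in the radius.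
  · obtain ⟨j, hj1, hj2⟩ : ∃ j, 2 * (N + j) < k ∧ k ≤ 2 * (N + j) + 2 :=
      ⟨(k - 1) / 2 - N, by lia, by lia⟩
    obtain ⟨F, hFc, hF⟩ := exists_finset_parabolicIndex_mem f (N + j) t
    have hopen : IsOpen {u | parabolicGauge f t u < 4⁻¹ ^ (N + j)} := by
      refine isOpen_lt ?_ continuous_const
      unfold parabolicGauge
      exact ENNReal.continuous_ofReal.comp (by fun_prop)
    have h42 (n : ℕ) : (4 : ℝ≥0∞)⁻¹ ^ n = 2⁻¹ ^ (2 * n) := by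
      rw [pow_mul, ← ENNReal.inv_pow (n := 2)]; norm_num
    have hlt : (2 : ℝ≥0∞)⁻¹ ^ k < 4⁻¹ ^ (N + j) := by
      rw [h42, ← ENNReal.inv_pow, ← ENNReal.inv_pow, ENNReal.inv_lt_inv]
      exact_mod_cast Nat.pow_lt_pow_right one_lt_two hj1
    have hle : (4 : ℝ≥0∞)⁻¹ ^ (N + j) ≤ 4 * 2⁻¹ ^ k := by
      calc (4 : ℝ≥0∞)⁻¹ ^ (N + j) = 4 * 2⁻¹ ^ (2 * (N + j) + 2) := by
            rw [h42, pow_add, mul_left_comm,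
              show (4 : ℝ≥0∞) * 2⁻¹ ^ 2 = 1 by
                rw [show (4 : ℝ≥0∞) = 2 ^ 2 by norm_num, ← mul_pow,
                  ENNReal.mul_inv_cancel (by simp) (by simp), one_pow], mul_one]
        _ ≤ 4 * 2⁻¹ ^ k := by
            gcongr 4 * ?_
            exact hpow hj2
    calc (ν : Measure I) {u | parabolicGauge f t u ≤ 2⁻¹ ^ k}
        ≤ (ν : Measure I) {u | parabolicGauge f t u < 4⁻¹ ^ (N + j)} :=
          measure_mono fun u hu ↦ lt_of_le_of_lt hu hlt
      _ ≤ C * (F.card * G j) := hν j _ F hopen hF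
      _ ≤ C * (3 ^ (d + 1) * ((d + 1) ^ (s : ℝ) * (4 * 2⁻¹ ^ k) ^ a)) := by
          rw [hFc, hG]
          push_cast
          gcongr
      _ = C₁ * (2⁻¹ ^ k) ^ a := by
          rw [ENNReal.mul_rpow_of_nonneg _ _ ha0.le, hC₁]
          ring
      _ ≤ _ := mul_le_mul' le_self_add le_rfl

/-! ### The two time measures and the conclusion -/

theorem volume_parabolicGauge_le {d : ℕ} (f : I → EuclideanSpace ℝ (Fin d)) (t : I) (k : ℕ) :
    (volume : Measure I) {u | parabolicGauge f t u ≤ 2⁻¹ ^ k} ≤ 2 * (2⁻¹ ^ k) ^ (1 : ℝ) := by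
  have h2 : (2 : ℝ≥0∞)⁻¹ ^ k = ENNReal.ofReal (((2 : ℝ) ^ k)⁻¹) := by
    rw [ENNReal.ofReal_inv_pow (by norm_num)]; norm_num
  have hsub : ((↑) : I → ℝ) '' {u | parabolicGauge f t u ≤ 2⁻¹ ^ k} ⊆
      Metric.closedBall (t : ℝ) ((2 ^ k)⁻¹) := by
    rintro _ ⟨u, hu, rfl⟩
    rw [Set.mem_ofPred_eq, h2, parabolicGauge, ENNReal.ofReal_le_ofReal_iff (by positivity),
      max_le_iff] at hu
    rw [Metric.mem_closedBall, Real.dist_eq, abs_sub_comm]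
    exact hu.1
  calc (volume : Measure I) {u | parabolicGauge f t u ≤ 2⁻¹ ^ k}
      = volume (((↑) : I → ℝ) '' {u | parabolicGauge f t u ≤ 2⁻¹ ^ k}) :=
        (MeasurableEmbedding.subtype_coe measurableSet_Icc).comap_apply _ _
    _ ≤ volume (Metric.closedBall (t : ℝ) ((2 ^ k)⁻¹)) := measure_mono hsub
    _ = 2 * (2⁻¹ ^ k) ^ (1 : ℝ) := by
        rw [Real.volume_closedBall, ENNReal.ofReal_mul (by norm_num), ENNReal.rpow_one, h2]
        simp

/-- Restricting to rational s leaves countably many null sets, so one almost sure event serves for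
all s < c. -/
theorem ae_const_le_dimH {Ω : Type*} [MeasurableSpace Ω] {P : Measure Ω} {X : Ω → ℝ≥0∞}
    {c : ℝ≥0∞} (h : ∀ s : NNReal, 0 < s → (s : ℝ≥0∞) < c → ∀ᵐ ω ∂P, (s : ℝ≥0∞) ≤ X ω) :
    ∀ᵐ ω ∂P, c ≤ X ω := by
  have h' : ∀ q : ℚ, 0 < q → ENNReal.ofReal q < c → ∀ᵐ ω ∂P, ENNReal.ofReal q ≤ X ω :=
    fun q hq hqc ↦ h (Real.toNNReal q) (by simpa using hq) hqc
  simp only [← Filter.eventually_imp_distrib_left, ← ae_all_iff] at h'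
  filter_upwards [h'] with ω hω
  refine le_of_forall_lt fun x hx ↦ ?_
  obtain ⟨q, hq, hxq, hqc⟩ := ENNReal.lt_iff_exists_rat_btwn.1 hx
  have hq0 : 0 < q := by
    refine lt_of_le_of_ne hq fun h0 ↦ ?_
    simp [← h0] at hxq
  exact hxq.trans_le (hω q hq0 hqc)

theorem ae_dimH_euclideanGraph_le {Ω : Type*} [MeasurableSpace Ω] {d : ℕ} (hd : 1 ≤ d)
    {B : I → Ω → EuclideanSpace ℝ (Fin d)} {P : Measure Ω} [IsProbabilityMeasure P]
    (hB : IsStandardBrownianMotion B P) {f : I → EuclideanSpace ℝ (Fin d)} (hf : Continuous f) :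
    ∀ᵐ ω ∂P, dimH (euclideanGraph f) ≤ dimH (euclideanGraph fun t ↦ B t ω + f t) := by
  refine ae_const_le_dimH fun s hs hlt ↦ ?_
  -- Frostman is applied at s' > s, so that max(s'/2, s' - d/2) strictly exceeds both exponents
  -- needed for s.
  obtain ⟨s', hss', hs'⟩ := ENNReal.lt_iff_exists_nnreal_btwn.1 hlt
  have h1 : (s : ℝ) < s' := by exact_mod_cast hss'
  obtain ⟨ν, C, hC, hν⟩ := exists_measure_parabolicGauge_le hf
    (hs.trans (by exact_mod_cast hss')) hs'
  refine ae_le_dimH_euclideanGraph hd hB hf ν hC hν hs (lt_max_of_lt_left ?_)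
    (lt_max_of_lt_right ?_) <;> linarith

/-- Lebesgue measure is regular with a = 1, so the conditions on s become s < 2 and s < 1 + d/2. -/
theorem ae_le_dimH_euclideanGraph_of_volume {Ω : Type*} [MeasurableSpace Ω] {d : ℕ} (hd : 1 ≤ d)
    {B : I → Ω → EuclideanSpace ℝ (Fin d)} {P : Measure Ω} [IsProbabilityMeasure P]
    (hB : IsStandardBrownianMotion B P) {f : I → EuclideanSpace ℝ (Fin d)} (hf : Continuous f)
    {c : NNReal} (hc1 : (c : ℝ) ≤ 2) (hc2 : (c : ℝ) ≤ 1 + d / 2) :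
    ∀ᵐ ω ∂P, (c : ℝ≥0∞) ≤ dimH (euclideanGraph fun t ↦ B t ω + f t) := by
  refine ae_const_le_dimH fun s hs hlt ↦ ?_
  have h1 : (s : ℝ) < c := by exact_mod_cast hlt
  refine ae_le_dimH_euclideanGraph hd hB hf volume (C := 2) (by simp)
    (volume_parabolicGauge_le f) hs ?_ ?_ <;> linarith

theorem theorem1p5 {Ω : Type*} [MeasurableSpace Ω] (P : Measure Ω) [IsProbabilityMeasure P]
    (d : ℕ) (B : I → Ω → EuclideanSpace ℝ (Fin d)) (hB : IsStandardBrownianMotion B P)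
    (f : I → EuclideanSpace ℝ (Fin d)) (hf : Continuous f) :
    (d = 1 → ∀ᵐ ω ∂P,
      max (3 / 2 : ℝ≥0∞) (dimH (euclideanGraph f)) ≤
        dimH (euclideanGraph fun t ↦ B t ω + f t)) ∧
    (2 ≤ d → ∀ᵐ ω ∂P,
      max (2 : ℝ≥0∞) (dimH (euclideanGraph f)) ≤
        dimH (euclideanGraph fun t ↦ B t ω + f t)) := by
  refine ⟨fun hd ↦ ?_, fun hd ↦ ?_⟩
  · have h := ae_le_dimH_euclideanGraph_of_volume hd.ge hB hf (c := 3 / 2)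
      (by push_cast; norm_num) (by rw [hd]; push_cast; norm_num)
    filter_upwards [h, ae_dimH_euclideanGraph_le hd.ge hB hf] with ω h1 h2
    refine max_le (le_trans (le_of_eq ?_) h1) h2
    rw [ENNReal.coe_div (by norm_num)]
    simp
  · have hd' : (2 : ℝ) ≤ d := by exact_mod_cast hd
    have h := ae_le_dimH_euclideanGraph_of_volume (one_le_two.trans hd) hB hf (c := 2)
      (by push_cast; norm_num) (by push_cast; linarith)
    filter_upwards [h, ae_dimH_euclideanGraph_le (one_le_two.trans hd) hB hf] with ω h1 h2
    exact max_le (by simpa using h1) h2
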